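/- Consider the following two-player mining game with maximum depth $d=100$. A state is a pair $(\ell_1,\ell_2)$ of integers with $0\le \ell_1,\ell_2\le d$, the lengths of the branches of players 1 and 2. Turns are decided by independent mining races; each race is won by player 1 with probability $p_1\in(0,1)$ and by player 2 with probability $1-p_1$. A capitulation policy of player 1 is a pair $(C,s)$ with $C:\{0,\dots,d\}^2\to\{0,1\}$ and $s\in\{0,\dots,d\}$. Player 2 plays Frontier. From $(\ell_1,\ell_2)$ the game moves as follows. - If player 1 wins the race, the next state is $(0,0)$ when $\ell_1\ge\ell_2$, and $(\ell_1+1,\ell_2)$ otherwise. - If player 2 wins the race, the next state is $(\ell_1,\ell_2+1)$ when player 1 continues at $(\ell_1,\ell_2)$, that is, when $C(\ell_1,\ell_2)=0$ and $\ell_2<d$; otherwise player 1 capitulates and the next state is $(0,s)$. Let $X_0=(0,0),X_1,X_2,\dots$ be the resulting Markov chain. The policy is safe for $T>0$ if $\mathcal T(d,d)=\mathbb E\big(\min\{n\in\mathbb N: X_n=(d,d)\}\big)\ge T$, where the minimum of the empty set is $+\infty$. A policy has constant gap tolerance $g$ if one of the following two conditions holds. (Both conventions are in use, and the result holds for both.)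 1. For every $\ell_1<d$, the largest value of $\ell_2-\ell_1$ over the states $(\ell_1,\ell_2)$ at which player 1 continues is $\min(g,\,d-1-\ell_1)$. 2. For every $\ell_1\le d$, the smallest value of $\ell_2-\ell_1\ge 0$ over the states $(\ell_1,\ell_2)$ at which player 1 capitulates if he loses the race is $\min(g,\,d-\ell_1)$. **Corollary.** Let $d=100$ and $T=10^8$. Every capitulation policy $(C,s)$ of player 1 with constant gap tolerance $g$ and $0\le s\le g\le 4$ is safe for $T$, for every $p_1\in(0,1)$. -/

import Mathlib

open MeasureTheory ProbabilityTheory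
open scoped ENNReal unitInterval

/-- A capitulation policy in the two-player mining game of maximum depth `d`.
`C ℓ₁ ℓ₂ = true` means: if a turn starts at the state `(ℓ₁, ℓ₂)` and the player loses the mining
race of that turn, then the player capitulates. `s` is the number of blocks of the opponent that
are left to surpass after a capitulation. -/
structure CapitulationPolicy (d : ℕ) where
  C : Fin (d + 1) → Fin (d + 1) → Bool
  s : Fin (d + 1)

namespace MiningGame

/-- The states `(ℓ₁, ℓ₂)`, `0 ≤ ℓ₁, ℓ₂ ≤ d`: lengths of the branches of players 1 and 2. -/
abbrev State (d : ℕ) : Type := Fin (d + 1) × Fin (d + 1)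

/-- The Frontier strategy as a capitulation policy of player 2: give up the branch as soon as
player 1 gets strictly ahead, and restart from the tip of the branch of player 1. -/
def frontierPolicy (d : ℕ) : CapitulationPolicy d where
  C := fun l₁ l₂ => decide (l₂ ≤ l₁)
  s := 0

/-- Player 1, using the policy `π`, keeps his branch at the state `(l₁, l₂)` if player 2 wins the
race. If `l₂ = d`, the branch of player 2 becomes longer than `d` and its first block is validated,
so that player 1 has to capitulate, whatever the policy says. -/
def Continues₁ {d : ℕ} (π : CapitulationPolicy d) (l₁ l₂ : Fin (d + 1)) : Prop :=
  π.C l₁ l₂ = false ∧ (l₂ : ℕ) < d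

/-- Player 2, using the policy `π`, keeps his branch at the state `(l₁, l₂)` if player 1 wins the
race. -/
def Continues₂ {d : ℕ} (π : CapitulationPolicy d) (l₁ l₂ : Fin (d + 1)) : Prop :=
  π.C l₁ l₂ = false ∧ (l₁ : ℕ) < d

open Classical in
/-- The state after one turn, when the players use the policies `π₁`, `π₂`. The mining race
of the turn is won by player 1 if `w = true`, and by player 2 if `w = false`. -/
noncomputable def step {d : ℕ} (π₁ π₂ : CapitulationPolicy d) (x : State d) (w : Bool) : State d :=
  if w = true then
    if h : Continues₂ π₂ x.1 x.2 then (⟨(x.1 : ℕ) + 1, Nat.succ_lt_succ h.2⟩, x.2)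
    else (π₂.s, 0)
  else
    if h : Continues₁ π₁ x.1 x.2 then (x.1, ⟨(x.2 : ℕ) + 1, Nat.succ_lt_succ h.2⟩)
    else (0, π₁.s)

/-- The Markov chain started at `(0, 0)`, as a function of the sequence `ω` of race winners. -/
noncomputable def chain {d : ℕ} (π₁ π₂ : CapitulationPolicy d) : ℕ → (ℕ → Bool) → State d
  | 0, _ => (0, 0)
  | n + 1, ω => step π₁ π₂ (chain π₁ π₂ n ω) (ω n)

/-- The law of the sequence of race winners: independent races, each of them won by player 1
with probability `p₁` and by player 2 with probability `1 - p₁`. -/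
noncomputable def raceMeasure (p₁ : I) : Measure (ℕ → Bool) :=
  Measure.infinitePi fun _ => bernoulliMeasure true false p₁

/-- The expected hitting time of `(d, d)` from `(0, 0)`, in `[0, ∞]`, when player 1 uses `π` and
player 2 plays Frontier. The hitting time is `∞` on the paths that never visit `(d, d)`. -/
noncomputable def expectedHittingTime {d : ℕ} (π : CapitulationPolicy d) (p₁ : I) : ℝ≥0∞ :=
  ∫⁻ ω, ENat.toENNReal
    (hittingAfter (chain π (frontierPolicy d)) {(Fin.last d, Fin.last d)} 0 ω) ∂(raceMeasure p₁)

/-- The policy `π` of player 1 is safe for the time horizon `T`. -/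
def IsSafe {d : ℕ} (π : CapitulationPolicy d) (p₁ : I) (T : ℝ≥0∞) : Prop :=
  T ≤ expectedHittingTime π p₁

/-- For every `l₁`, the largest gap `l₂ - l₁` at which player 1 continues is `g`
(or the largest one that `l₂ < d` permits, if `l₁ + g ≥ d`). -/
def ContinuesUpToGap {d : ℕ} (π : CapitulationPolicy d) (g : ℕ) : Prop :=
  ∀ l₁ : Fin (d + 1), (l₁ : ℕ) < d →
    IsGreatest {k : ℤ | ∃ l₂ : Fin (d + 1), Continues₁ π l₁ l₂ ∧ k = (l₂ : ℤ) - (l₁ : ℤ)}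
      (min (g : ℤ) ((d : ℤ) - 1 - (l₁ : ℤ)))

/-- For every `l₁`, the first state `(l₁, l₂)` with `l₂ ≥ l₁` at which player 1 capitulates if he
loses the race is the one with the gap `l₂ - l₁ = g` (or with `l₂ = d`, if `l₁ + g ≥ d`). -/
def CapitulatesFromGap {d : ℕ} (π : CapitulationPolicy d) (g : ℕ) : Prop :=
  ∀ l₁ : Fin (d + 1),
    IsLeast {k : ℤ | ∃ l₂ : Fin (d + 1), l₁ ≤ l₂ ∧ ¬ Continues₁ π l₁ l₂ ∧
        k = (l₂ : ℤ) - (l₁ : ℤ)}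
      (min (g : ℤ) ((d : ℤ) - (l₁ : ℤ)))

/-- Constant gap tolerance `g`. In the literature `g` is used both for the largest gap at which
player 1 still continues and for the largest gap that occurs among the states of the chain, at
which player 1 capitulates when he loses the race. Policies of both kinds are included. -/
def HasConstantGapTolerance {d : ℕ} (π : CapitulationPolicy d) (g : ℕ) : Prop :=
  ContinuesUpToGap π g ∨ CapitulatesFromGap π g

end MiningGame

namespace MiningGame

/-! ### Lower bounds for expected hitting times -/

section HittingTime

variable {d : ℕ} (π₁ π₂ : CapitulationPolicy d)

/-! Each excursion between restarts reaches (100, 100) with probability at most about 10⁻⁹,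
uniformly in `p₁`. Before a restart only the gap `b - a` is constrained: it stays in {0, …, 5}. All
paths from `(a, b)` to (100, 100) have the same probability `p ^ (100 - a) * (1 - p) ^ (100 - b)`,
and the number of those that stay in the strip grows like powers of 2 cos(π/7), the largest
eigenvalue of the path graph on six vertices. Since 2 cos(π/7) < 2, the product is tiny even for the
worst `p`.

`reachBound` packages this as a function `u` that is superharmonic if restarts are ignored
(`reachBound_forward`) and at most ε = 5 / 10⁹ at restart states (`reachBound_restart_le`). Hence
the mean of `u` rises by at most ε per turn, and `(1 - u) / ε` loses at most 1 per turn and vanishes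
at the target. By the optional stopping argument of `le_lintegral_hittingAfter` it bounds the
expected hitting time from below. -/

instance (p : I) : IsProbabilityMeasure (raceMeasure p) := by
  unfold raceMeasure; infer_instance

/-- The races before time `n`. -/
@[reducible] def history (n : ℕ) : MeasurableSpace (ℕ → Bool) :=
  ⨆ i ∈ Set.Iio n, MeasurableSpace.comap (fun ω : ℕ → Bool => ω i) inferInstance

lemma history_le (n : ℕ) : history n ≤ (inferInstance : MeasurableSpace (ℕ → Bool)) :=
  iSup₂_le fun i _ => (measurable_pi_apply i).comap_le

lemma history_mono {m n : ℕ} (h : m ≤ n) : history m ≤ history n :=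
  biSup_mono fun _ hi => lt_of_lt_of_le hi h

lemma measurable_race_history (n : ℕ) : Measurable[history (n + 1)] fun ω : ℕ → Bool => ω n :=
  measurable_iff_comap_le.2
    (le_biSup (fun i => MeasurableSpace.comap (fun ω : ℕ → Bool => ω i) inferInstance)
      (Set.mem_Iio.2 n.lt_succ_self))

lemma measurable_chain_history (n : ℕ) : Measurable[history n] (chain π₁ π₂ n) := by
  induction n with
  | zero => exact @measurable_const _ _ _ (history 0) _
  | succ n ih =>
    have h : Measurable fun y : State d × Bool => step π₁ π₂ y.1 y.2 := measurable_of_countable _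
    exact h.comp ((ih.mono (history_mono n.le_succ) le_rfl).prodMk (measurable_race_history n))

/-- The paths that have not visited `t` up to time `n`. -/
def avoids (t : State d) (n : ℕ) : Set (ℕ → Bool) :=
  {ω | ∀ k ≤ n, chain π₁ π₂ k ω ≠ t}

lemma measurableSet_avoids (t : State d) (n : ℕ) :
    MeasurableSet[history n] (avoids π₁ π₂ t n) := by
  have : avoids π₁ π₂ t n = ⋂ k ∈ Set.Iic n, chain π₁ π₂ k ⁻¹' {t}ᶜ := by
    ext; simp [avoids]
  rw [this]
  refine MeasurableSet.biInter (Set.to_countable _) fun k hk => ?_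
  exact history_mono hk _ (measurable_chain_history π₁ π₂ k (measurableSet_singleton t).compl)

/-- Race `n` is independent of the races before it; this plays the role of the Markov property. -/
lemma lintegral_mul_race (p : I) (n : ℕ) {F : (ℕ → Bool) → ℝ≥0∞} (hF : Measurable[history n] F)
    (G : Bool → ℝ≥0∞) :
    ∫⁻ ω, F ω * G (ω n) ∂(raceMeasure p) =
      (∫⁻ ω, F ω ∂(raceMeasure p)) *
        (ENNReal.ofReal p * G true + ENNReal.ofReal (1 - p) * G false) := by
  have hi : iIndepFun (fun i (ω : ℕ → Bool) => ω i) (raceMeasure p) :=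
    iIndepFun_infinitePi (X := fun _ (b : Bool) => b) fun _ => measurable_id
  have hind : Indep (history n) (MeasurableSpace.comap (fun ω : ℕ → Bool => ω n) inferInstance)
      (raceMeasure p) := by
    have := indep_iSup_of_disjoint (fun i => (measurable_pi_apply i).comap_le) hi
      (S := Set.Iio n) (T := {n}) (by simp)
    simpa [history] using this
  have hG : Measurable G := measurable_of_countable _
  have hmul := lintegral_mul_eq_lintegral_mul_lintegral_of_independent_measurableSpace
    (history_le n) (measurable_pi_apply n).comap_le hind hF
    (hG.comp (comap_measurable fun ω : ℕ → Bool => ω n))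
  simp only [Function.comp_apply] at hmul
  rw [hmul]
  congr 1
  have hmap : (raceMeasure p).map (fun ω => ω n) = bernoulliMeasure true false p :=
    Measure.infinitePi_map_eval _ n
  rw [← lintegral_map (f := G) hG (measurable_pi_apply n), hmap, bernoulliMeasure_def,
    lintegral_add_measure, lintegral_smul_measure, lintegral_smul_measure, lintegral_dirac,
    lintegral_dirac, ENNReal.smul_def, ENNReal.smul_def]
  congr 2
  · exact (ENNReal.ofReal_coe_nnreal (p := unitInterval.toNNReal p)).symm
  · exact (ENNReal.ofReal_coe_nnreal (p := unitInterval.toNNReal (unitInterval.symm p))).symm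

/-- The sum of the indicators of the times before the hitting time is at most the hitting time. -/
lemma tsum_indicator_avoids_le (t : State d) (ω : ℕ → Bool) :
    ∑' n, (avoids π₁ π₂ t n).indicator (1 : (ℕ → Bool) → ℝ≥0∞) ω ≤
      ENat.toENNReal (hittingAfter (chain π₁ π₂) {t} 0 ω) := by
  by_cases h : ∃ j, 0 ≤ j ∧ chain π₁ π₂ j ω ∈ ({t} : Set (State d))
  · have hm := hittingAfter_mem_set h
    rw [hittingAfter, if_pos h] at hm ⊢
    set m := sInf {i : ℕ | 0 ≤ i ∧ chain π₁ π₂ i ω ∈ ({t} : Set (State d))}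
    have hm' : chain π₁ π₂ m ω = t := hm
    rw [tsum_eq_sum (s := Finset.range m) fun k hk => Set.indicator_of_notMem
      (fun hk' : ω ∈ avoids π₁ π₂ t k => hk' m (not_lt.1 (Finset.mem_range.not.1 hk)) hm') _]
    calc _ ≤ ∑ _k ∈ Finset.range m, (1 : ℝ≥0∞) :=
          Finset.sum_le_sum fun k _ => Set.indicator_le_self' (fun _ _ => zero_le) ω
      _ = m := by simp
      _ = _ := (ENat.toENNReal_coe m).symm
  · rw [hittingAfter, if_neg h]
    exact le_top

/-- A bounded function `f` that vanishes at `t` and that loses at most `1` on average in each turn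
before `t` is visited is a lower bound of the expected hitting time of `t`. -/
theorem le_lintegral_hittingAfter (p : I) (t : State d) (f : State d → ℝ≥0∞) (B : ℝ≥0∞)
    (hB : B ≠ ⊤) (hfB : ∀ x, f x ≤ B) (ht : f t = 0) (S : Set (State d)) (h0 : (0, 0) ∈ S)
    (hS : ∀ x ∈ S, ∀ w, step π₁ π₂ x w ∈ S)
    (hf : ∀ x ∈ S, x ≠ t → f x ≤ 1 + (ENNReal.ofReal p * f (step π₁ π₂ x true) +
      ENNReal.ofReal (1 - p) * f (step π₁ π₂ x false))) :
    f (0, 0) ≤ ∫⁻ ω, ENat.toENNReal (hittingAfter (chain π₁ π₂) {t} 0 ω) ∂(raceMeasure p) := by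
  set μ := raceMeasure p
  have hmem (n ω) : chain π₁ π₂ n ω ∈ S := by
    induction n with
    | zero => exact h0
    | succ n ih => exact hS _ ih _
  let A := avoids π₁ π₂ t
  have hA (n) : MeasurableSet[history n] (A n) := measurableSet_avoids π₁ π₂ t n
  have hA' (n) : MeasurableSet (A n) := history_le n _ (hA n)
  have hsum : ∑' n, μ (A n) ≤
      ∫⁻ ω, ENat.toENNReal (hittingAfter (chain π₁ π₂) {t} 0 ω) ∂μ := by
    calc ∑' n, μ (A n) = ∑' n, ∫⁻ ω, (A n).indicator 1 ω ∂μ := by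
          simp [hA']
      _ = ∫⁻ ω, ∑' n, (A n).indicator 1 ω ∂μ :=
          (lintegral_tsum fun n => (measurable_one.indicator (hA' n)).aemeasurable).symm
      _ ≤ _ := lintegral_mono (tsum_indicator_avoids_le π₁ π₂ t)
  refine le_trans ?_ hsum
  let J (n : ℕ) : ℝ≥0∞ := ∫⁻ ω, (A n).indicator 1 ω * f (chain π₁ π₂ n ω) ∂μ
  have hfm (g : State d → ℝ≥0∞) (n) : Measurable[history n] fun ω =>
      (A n).indicator (1 : (ℕ → Bool) → ℝ≥0∞) ω * g (chain π₁ π₂ n ω) := by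
    refine Measurable.mul ?_ ?_
    · exact Measurable.indicator (m := history n) (@measurable_const _ _ _ (history n) 1) (hA n)
    · exact (measurable_of_countable g).comp (measurable_chain_history π₁ π₂ n)
  have hfm' (g n) := (hfm g n).mono (history_le n) le_rfl
  have hJ (n) : J n ≤ μ (A n) + J (n + 1) := by
    let g (w : Bool) (x : State d) : ℝ≥0∞ := f (step π₁ π₂ x w)
    let e (w v : Bool) : ℝ≥0∞ := if v = w then 1 else 0
    have hnext (ω) : (A (n + 1)).indicator 1 ω * f (chain π₁ π₂ (n + 1) ω) =
        (A n).indicator 1 ω * g true (chain π₁ π₂ n ω) * e true (ω n) +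
        (A n).indicator 1 ω * g false (chain π₁ π₂ n ω) * e false (ω n) := by
      -- The two indicators differ only when the chain is at `t` at time `n + 1`, where `f`
      -- vanishes.
      have h1 : (A (n + 1)).indicator 1 ω * f (chain π₁ π₂ (n + 1) ω) =
          (A n).indicator 1 ω * f (chain π₁ π₂ (n + 1) ω) := by
        by_cases hx : chain π₁ π₂ (n + 1) ω = t
        · simp [hx, ht]
        · congr 1
          have : ω ∈ A (n + 1) ↔ ω ∈ A n := by
            refine ⟨fun h k hk => h k (hk.trans n.le_succ), fun h k hk => ?_⟩
            rcases hk.lt_or_eq with hk | rfl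
            · exact h k (Nat.lt_succ_iff.1 hk)
            · exact hx
          by_cases h : ω ∈ A n <;> simp [h, this.2, this]
      rw [h1, chain]
      cases hw : ω n <;> simp [g, e]
    have hJs : J (n + 1) = ∫⁻ ω, ((A n).indicator 1 ω *
        (ENNReal.ofReal p * g true (chain π₁ π₂ n ω) +
          ENNReal.ofReal (1 - p) * g false (chain π₁ π₂ n ω))) ∂μ := by
      have hm (w) := hfm' (g w) n
      have he (w) : Measurable fun ω : ℕ → Bool => e w (ω n) :=
        (measurable_of_countable (e w)).comp (measurable_pi_apply n)
      simp only [J, hnext]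
      rw [lintegral_add_left (by exact (hm true).mul (he true)), lintegral_mul_race p n (hfm _ n),
        lintegral_mul_race p n (hfm _ n)]
      simp only [e, if_true, if_false, Bool.false_eq_true, Bool.true_eq_false, mul_one, mul_zero,
        add_zero, zero_add]
      rw [← lintegral_mul_const _ (hm true), ← lintegral_mul_const _ (hm false),
        ← lintegral_add_left (by exact (hm true).mul_const _)]
      refine lintegral_congr fun ω => ?_
      ring
    have hAn : μ (A n) = ∫⁻ ω, (A n).indicator 1 ω ∂μ := (lintegral_indicator_one (hA' n)).symm
    rw [hJs, hAn, ← lintegral_add_left (measurable_one.indicator (hA' n))]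
    refine lintegral_mono fun ω => ?_
    by_cases hω : ω ∈ A n
    · simpa [hω] using hf _ (hmem n ω) (hω n le_rfl)
    · simp [hω]
  have hJ0 : f (0, 0) ≤ J 0 := by
    by_cases h : ((0, 0) : State d) = t
    · simp [h, ht]
    · have : A 0 = Set.univ := by ext; simpa [A, avoids, chain] using h
      simp [J, this, chain, μ]
  have hsumJ (n) : f (0, 0) ≤ ∑ k ∈ Finset.range n, μ (A k) + J n := by
    induction n with
    | zero => simpa using hJ0
    | succ n ih =>
      rw [Finset.sum_range_succ, add_assoc]
      exact ih.trans (by gcongr; exact hJ n)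
  have hJB (n) : J n ≤ B * μ (A n) := by
    rw [← lintegral_indicator_one (hA' n), ← lintegral_const_mul _
      (measurable_one.indicator (hA' n))]
    refine lintegral_mono fun ω => ?_
    rw [mul_comm]
    gcongr
    exact hfB _
  -- If the series converges, its terms tend to 0, and so does the remainder `J n ≤ B * μ (A n)`.
  by_cases hfin : ∑' n, μ (A n) = ⊤
  · rw [hfin]; exact le_top
  have hlim := ENNReal.Tendsto.const_mul (ENNReal.tendsto_atTop_zero_of_tsum_ne_top hfin)
    (Or.inr hB)
  rw [mul_zero] at hlim
  have := ge_of_tendsto' (hlim.const_add (∑' n, μ (A n))) fun n =>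
    (hsumJ n).trans (add_le_add (ENNReal.sum_le_tsum _) (hJB n))
  simpa using this

end HittingTime

/-! ### Weighted path counting in a strip -/

/-- The maximum of `x ^ m * y ^ n` on the segment `x + y = 1`. -/
lemma pow_mul_pow_le_of_add_eq_one {x y : ℝ} (hx : 0 ≤ x) (hy : 0 ≤ y) (hxy : x + y = 1)
    {m n : ℕ} (hm : 0 < m) (hn : 0 < n) :
    x ^ m * y ^ n ≤ ((m : ℝ) / (m + n)) ^ m * ((n : ℝ) / (m + n)) ^ n := by
  have hm' : (0 : ℝ) < m := by exact_mod_cast hm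
  have hn' : (0 : ℝ) < n := by exact_mod_cast hn
  -- From `1 + t ≤ exp t` at `t = z * (m + n) / k - 1`; in the product of the two bounds the
  -- exponentials cancel because `x + y = 1`.
  have key (k : ℕ) (hk : (0 : ℝ) < k) (z : ℝ) (hz : 0 ≤ z) :
      z ^ k ≤ ((k : ℝ) / (m + n)) ^ k * Real.exp ((m + n) * z - k) := by
    have h := Real.add_one_le_exp (z * (m + n) / k - 1)
    rw [sub_add_cancel, div_le_iff₀ hk] at h
    have hz' : z ≤ (k : ℝ) / (m + n) * Real.exp (z * (m + n) / k - 1) := by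
      rw [div_mul_eq_mul_div, le_div_iff₀ (by positivity)]
      linarith
    calc z ^ k ≤ ((k : ℝ) / (m + n) * Real.exp (z * (m + n) / k - 1)) ^ k := by gcongr
      _ = _ := by
        rw [mul_pow, ← Real.exp_nat_mul]
        congr 2
        field_simp
  calc x ^ m * y ^ n ≤ _ := mul_le_mul (key m hm' x hx) (key n hn' y hy) (by positivity)
        (by positivity)
    _ = ((m : ℝ) / (m + n)) ^ m * ((n : ℝ) / (m + n)) ^ n *
        Real.exp ((m + n) * (x + y) - (m + n)) := by
      rw [mul_mul_mul_comm, ← Real.exp_add]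
      congr 2
      ring
    _ = _ := by simp [hxy]

/-- A superharmonic function with eigenvalue `901 / 500 > 2 cos (π / 7)` on the path with the
vertices `0, …, 5`. -/
noncomputable def gapWeight : ℕ → ℝ
  | 0 => 1
  | 1 => 901 / 500
  | 2 => (901 / 500) ^ 2 - 1
  | 3 => (901 / 500) ^ 2 - 1
  | 4 => 901 / 500
  | 5 => 1
  | _ => 0

lemma gapWeight_nonneg (k : ℕ) : 0 ≤ gapWeight k := by
  unfold gapWeight; split <;> norm_num

lemma gapWeight_one_le : gapWeight 1 ≤ 901 / 500 * gapWeight 0 := by norm_num [gapWeight]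

/-- With λ = 901/500, equality holds except for `k = 1, 2`, where the claim is λ³ - λ² - 2λ + 1 ≥ 0;
the largest root of this cubic is 2 cos(π/7). The value 0 at 6 is the boundary condition of the
strip. -/
lemma gapWeight_add_le {k : ℕ} (hk : k ≤ 4) :
    gapWeight k + gapWeight (k + 2) ≤ 901 / 500 * gapWeight (k + 1) := by
  interval_cases k <;> norm_num [gapWeight]

/-- An upper bound of the probability of reaching `(100, 100)` from `(a, b)` before the next
return to a state `(0, s)`, when only gaps `b - a ≤ 5` are tolerated. -/
noncomputable def reachBound (p : ℝ) (a b : ℕ) : ℝ :=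
  p ^ (100 - a) * (1 - p) ^ (100 - b) * (901 / 500) ^ (100 - a + (100 - b)) * gapWeight (b - a)

section ReachBound

variable {p : ℝ}

lemma reachBound_nonneg (h0 : 0 ≤ p) (h1 : p ≤ 1) (a b : ℕ) : 0 ≤ reachBound p a b := by
  have := gapWeight_nonneg (b - a)
  have : 0 ≤ 1 - p := by linarith
  unfold reachBound
  positivity

/-- The worst `p` is near 1/2, which gives roughly 0.901 ^ (200 - s) times a weight below 2.3. -/
lemma reachBound_restart_le (h0 : 0 ≤ p) (h1 : p ≤ 1) {s : ℕ} (hs : s ≤ 4) :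
    reachBound p 0 s ≤ 5 / 10 ^ 9 := by
  have h := pow_mul_pow_le_of_add_eq_one h0 (sub_nonneg.2 h1) (add_sub_cancel p 1)
    (m := 100) (n := 100 - s) (by norm_num) (by omega)
  unfold reachBound
  rw [mul_assoc]
  refine (mul_le_mul_of_nonneg_right h (mul_nonneg (by positivity) (gapWeight_nonneg _))).trans ?_
  interval_cases s <;> norm_num [gapWeight]

/-- The two summands of the mean of `reachBound` after one turn, without restarts. -/
lemma reachBound_forward (h0 : 0 ≤ p) (h1 : p ≤ 1) {a b : ℕ} (hab : a ≤ b) (hb : b ≤ 100)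
    (hgap : b ≤ a + 5) (c₁ c₂ : Prop) [Decidable c₁] [Decidable c₂] (hc₁ : c₁ → a < b)
    (hc₂ : c₂ → b < 100 ∧ b < a + 5) :
    p * (if c₁ then reachBound p (a + 1) b else 0) +
      (1 - p) * (if c₂ then reachBound p a (b + 1) else 0) ≤ reachBound p a b := by
  have hq : 0 ≤ 1 - p := by linarith
  obtain ⟨k, rfl⟩ := Nat.exists_eq_add_of_le hab
  have hk : k ≤ 5 := by omega
  -- the common factor of the three terms
  set D : ℝ := p ^ (100 - a) * (1 - p) ^ (100 - (a + k)) *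
    (901 / 500) ^ (100 - a + (100 - (a + k)) - 1)
  have hD : 0 ≤ D := by positivity
  have e₁ (h : c₁) : p * reachBound p (a + 1) (a + k) = D * gapWeight (k - 1) := by
    have := hc₁ h
    have i1 : 100 - a = (100 - (a + 1)) + 1 := by omega
    have i2 : 100 - a + (100 - (a + k)) - 1 = 100 - (a + 1) + (100 - (a + k)) := by omega
    have i3 : a + k - (a + 1) = k - 1 := by omega
    simp only [D, reachBound, i2, i3]
    rw [i1, pow_succ]
    ring
  have e₂ (h : c₂) : (1 - p) * reachBound p a (a + k + 1) = D * gapWeight (k + 1) := by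
    have := hc₂ h
    have i1 : 100 - (a + k) = (100 - (a + k + 1)) + 1 := by omega
    have i2 : 100 - a + (100 - (a + k)) - 1 = 100 - a + (100 - (a + k + 1)) := by omega
    have i3 : a + k + 1 - a = k + 1 := by omega
    simp only [D, reachBound, i2, i3]
    rw [i1, pow_succ]
    ring
  have e₃ (h : a < 100) : reachBound p a (a + k) = D * (901 / 500 * gapWeight k) := by
    have i2 : 100 - a + (100 - (a + k)) = 100 - a + (100 - (a + k)) - 1 + 1 := by omega
    have i3 : a + k - a = k := by omega
    simp only [D, reachBound, i3]
    rw [i2, pow_succ, Nat.add_sub_cancel]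
    ring
  -- For `a = 100` also `b = 100`: the exponent in `D` is truncated, so `e₃` is unavailable, but
  -- neither move is possible.
  by_cases ha : a < 100
  · rw [e₃ ha]
    have hle₁ : p * (if c₁ then reachBound p (a + 1) (a + k) else 0) ≤
        D * (if 0 < k then gapWeight (k - 1) else 0) := by
      split_ifs with h h' h'
      · exact (e₁ h).le
      · exact absurd (hc₁ h) (by omega)
      · simpa using mul_nonneg hD (gapWeight_nonneg _)
      · simp
    have hle₂ : (1 - p) * (if c₂ then reachBound p a (a + k + 1) else 0) ≤
        D * gapWeight (k + 1) := by
      split_ifs with h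
      · exact (e₂ h).le
      · simpa using mul_nonneg hD (gapWeight_nonneg _)
    refine (add_le_add hle₁ hle₂).trans ?_
    rw [← mul_add]
    gcongr
    rcases k with _ | k
    · simpa using gapWeight_one_le
    · simpa using gapWeight_add_le (k := k) (by omega)
  · have n₁ : ¬ c₁ := fun h => by have := hc₁ h; omega
    have n₂ : ¬ c₂ := fun h => by have := hc₂ h; omega
    simpa [n₁, n₂] using reachBound_nonneg h0 h1 a (a + k)

end ReachBound

/-! ### Confinement to the strip and conclusion -/

/-- With a constant gap tolerance `g`, player 1 never exceeds some gap `G ≤ g + 1`. -/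
lemma HasConstantGapTolerance.exists_gap_bound {d g : ℕ} {π : CapitulationPolicy d}
    (hπ : HasConstantGapTolerance π g) :
    ∃ G, g ≤ G ∧ G ≤ g + 1 ∧ ∀ a b : Fin (d + 1), a ≤ b → (b : ℕ) ≤ a + G →
      Continues₁ π a b → (b : ℕ) < a + G := by
  rcases hπ with hπ | hπ
  -- Continuing at the gap `g` and losing leads to the gap `g + 1`, hence the shift.
  · refine ⟨g + 1, by omega, le_rfl, fun a b hab _ hc => ?_⟩
    have hab' : (a : ℕ) ≤ b := hab
    have := (hπ a (by have := hc.2; omega)).2 ⟨b, hc, rfl⟩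
    have := this.trans (min_le_left _ _)
    omega
  · refine ⟨g, le_rfl, by omega, fun a b hab hb hc => ?_⟩
    by_contra hlt
    obtain ⟨c, -, hcont, hc'⟩ := (hπ a).1
    have := hc.2
    rw [min_eq_left (by omega)] at hc'
    have : c = b := Fin.ext (by omega)
    exact hcont (this ▸ hc)

end MiningGame

open MiningGame in
theorem mainTheorem8 (π : CapitulationPolicy 100) (g : ℕ)
    (hπ : MiningGame.HasConstantGapTolerance π g)
    (hs : (π.s : ℕ) ≤ g) (hg : g ≤ 4)
    (p₁ : unitInterval) (hp₀ : 0 < p₁) (hp₁ : p₁ < 1) :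
    MiningGame.IsSafe π p₁ (10 ^ 8) := by
  obtain ⟨G, hgG, hG, hgap⟩ := hπ.exists_gap_bound
  have h0 : (0 : ℝ) ≤ p₁ := p₁.2.1
  have h1 : (p₁ : ℝ) ≤ 1 := p₁.2.2
  set p : ℝ := (p₁ : ℝ)
  have hq : 0 ≤ 1 - p := by linarith
  have frontierPolicy_s : (frontierPolicy 100).s = 0 := rfl
  let u (x : State 100) : ℝ := reachBound p x.1 x.2
  have hu (x) : 0 ≤ u x := reachBound_nonneg h0 h1 _ _
  -- Frontier keeps the gap nonnegative, and restarts stay in this strip because `s ≤ g ≤ G`.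
  let S : Set (State 100) := {x | x.1 ≤ x.2 ∧ (x.2 : ℕ) ≤ x.1 + G}
  have hFr (x : State 100) : Continues₂ (frontierPolicy 100) x.1 x.2 ↔ x.1 < x.2 := by
    have := x.2.2
    simp only [Continues₂, frontierPolicy, decide_eq_false_iff_not, not_le, and_iff_left_iff_imp]
    intro h
    have : (x.1 : ℕ) < x.2 := h
    omega
  have hε₀ : u (0, 0) ≤ 5 / 10 ^ 9 := reachBound_restart_le h0 h1 (s := 0) (by norm_num)
  have hεs : u (0, π.s) ≤ 5 / 10 ^ 9 := reachBound_restart_le h0 h1 (hs.trans hg)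
  have hmean (x) (hx : x ∈ S) : p * u (step π (frontierPolicy 100) x true) +
      (1 - p) * u (step π (frontierPolicy 100) x false) ≤ u x + 5 / 10 ^ 9 := by
    classical
    obtain ⟨hx₁, hx₂⟩ := hx
    have hx₁' : (x.1 : ℕ) ≤ x.2 := hx₁
    have hf := reachBound_forward h0 h1 hx₁' (Nat.lt_succ_iff.1 x.2.2) (by omega)
      (Continues₂ (frontierPolicy 100) x.1 x.2) (Continues₁ π x.1 x.2)
      (fun h => (hFr x).1 h) (fun h => ⟨h.2, by have := hgap _ _ hx₁ hx₂ h; omega⟩)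
    have ht : u (step π (frontierPolicy 100) x true) ≤
        (if Continues₂ (frontierPolicy 100) x.1 x.2 then reachBound p (x.1 + 1) x.2 else 0) +
          5 / 10 ^ 9 := by
      by_cases h : Continues₂ (frontierPolicy 100) x.1 x.2
      · simp [step, h, u]
        norm_num
      · simpa [step, h, frontierPolicy_s] using hε₀
    have hf' : u (step π (frontierPolicy 100) x false) ≤
        (if Continues₁ π x.1 x.2 then reachBound p x.1 (x.2 + 1) else 0) + 5 / 10 ^ 9 := by
      by_cases h : Continues₁ π x.1 x.2
      · simp [step, h, u]
        norm_num
      · simpa [step, h] using hεs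
    have := mul_le_mul_of_nonneg_left ht h0
    have := mul_le_mul_of_nonneg_left hf' hq
    change _ ≤ reachBound p x.1 x.2 + _
    linarith
  -- The factor is the reciprocal of 5 / 10⁹. Where `u` exceeds 1, `f` is truncated to 0;
  -- subadditivity of `ENNReal.ofReal` makes this harmless.
  let f (x : State 100) : ℝ≥0∞ := ENNReal.ofReal (2 * 10 ^ 8 * (1 - u x))
  have hmain : f (0, 0) ≤ expectedHittingTime π p₁ := by
    refine le_lintegral_hittingAfter π (frontierPolicy 100) p₁ _ f (ENNReal.ofReal (2 * 10 ^ 8))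
      ENNReal.ofReal_ne_top (fun x => ENNReal.ofReal_le_ofReal ?_) ?_ S ?_ ?_ ?_
    · linarith [hu x]
    · simp [f, u, reachBound, gapWeight]
    · simp [S]
    · rintro x ⟨hx₁, hx₂⟩ w
      have hx₁' : (x.1 : ℕ) ≤ x.2 := hx₁
      cases w
      · by_cases h : Continues₁ π x.1 x.2
        · have := hgap _ _ hx₁ hx₂ h
          simp only [step, h, S, Set.mem_ofPred_eq, Fin.le_def]
          simp
          omega
        · simp [step, h, S]
          omega
      · by_cases h : Continues₂ (frontierPolicy 100) x.1 x.2
        · have : (x.1 : ℕ) < x.2 := (hFr x).1 h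
          simp only [step, h, S, Set.mem_ofPred_eq, Fin.le_def]
          simp
          omega
        · simp [step, h, S, frontierPolicy_s]
    · intro x hx _
      have := hmean x hx
      simp only [f]
      rw [← ENNReal.ofReal_mul h0, ← ENNReal.ofReal_mul hq, ← ENNReal.ofReal_one]
      refine (ENNReal.ofReal_le_ofReal ?_).trans (ENNReal.ofReal_add_le.trans
        (add_le_add le_rfl ENNReal.ofReal_add_le))
      linarith
  refine le_trans ?_ hmain
  have : (10 ^ 8 : ℝ≥0∞) = ENNReal.ofReal (10 ^ 8) := by
    rw [ENNReal.ofReal_pow (by norm_num)]; norm_num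
  rw [this]
  exact ENNReal.ofReal_le_ofReal (by linarith)
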